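/- Let $R$ be an associative ring with identity, $\alpha$ an automorphism of $R$ and $\delta$ an $\alpha$-derivation of $R$, i.e. an additive map with $\delta(ab)=\delta(a)b+\alpha(a)\delta(b)$ for all $a,b\in R$. Assume that $R$ is $\alpha$-compatible: for all $a,b\in R$, $ab=0$ if and only if $a\alpha(b)=0$. Let $R((x^{-1};\alpha,\delta))$ be the skew inverse Laurent series ring: its elements are the formal series $\sum_{i\ge m}a_ix^{-i}$ with $m\in\mathbb Z$ and $a_i\in R$, added coefficientwise and multiplied subject to $xa=\alpha(a)x+\delta(a)$ and $x^{-1}a=\sum_{i\ge 1}\alpha^{-1}(-\delta\alpha^{-1})^{i-1}(a)x^{-i}$ for $a\in R$. Let $R[[x^{-1};\alpha,\delta]]$ be its subring of the series $\sum_{i\ge 0}a_ix^{-i}$. If $R$ is prime (respectively semiprime), then $R((x^{-1};\alpha,\delta))$ and $R[[x^{-1};\alpha,\delta]]$ are prime (respectively semiprime). Moreover, if $R$ is prime, then both rings are right $\mathfrak{cP}$-Baer, where a ring $A$ is right $\mathfrak{cP}$-Baer if for every cyclic projective right $A$-module $P$ the right annihilator $\{r\in A : Pr=0\}$ equals $cA$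 for some idempotent $c\in A$. -/

import Mathlib

universe u

/-- A ring `A` is prime if `A ≠ 0` and `a A b = 0` implies `a = 0` or `b = 0`. -/
def IsPrimeRing (A : Type u) [Ring A] : Prop :=
  Nontrivial A ∧ ∀ a b : A, (∀ r : A, a * r * b = 0) → a = 0 ∨ b = 0

/-- A ring `A` is semiprime if `a A a = 0` implies `a = 0`. -/
def IsSemiprimeRing (A : Type u) [Ring A] : Prop :=
  ∀ a : A, (∀ r : A, a * r * a = 0) → a = 0

/-- A ring `A` is right cP-Baer if the right annihilator `r_A(P)` of every cyclic projective right
`A`-module `P` is of the form `c A` with `c` an idempotent. Right `A`-modules are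
`Aᵐᵒᵖ`-modules. -/
def IsRightCPBaer (A : Type u) [Ring A] : Prop :=
  ∀ (P : Type u) [AddCommGroup P] [Module Aᵐᵒᵖ P],
    Module.Projective Aᵐᵒᵖ P →
    (∃ p : P, Submodule.span Aᵐᵒᵖ {p} = ⊤) →
    ∃ c : A, IsIdempotentElem c ∧
      {r : A | ∀ p : P, MulOpposite.op r • p = 0} = {r : A | ∃ s : A, r = c * s}

/-- `R` is `α`-compatible: `a b = 0` if and only if `a α(b) = 0`. -/
def IsCompatibleEndo {R : Type u} [Ring R] (α : R →+* R) : Prop :=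
  ∀ a b : R, a * b = 0 ↔ a * α b = 0

/-- An `α`-derivation: an additive map with `δ (a b) = δ(a) b + α(a) δ(b)`. -/
structure SkewDerivation {R : Type u} [Ring R] (α : R →+* R) extends R →+ R where
  leibniz' : ∀ a b : R, toFun (a * b) = toFun a * b + α a * toFun b

/-- The additive group of formal series `∑_{i ≥ m} a_i x^{-i}`, `m` an integer depending on the
series; the series is given by its coefficients `i ↦ a_i`. -/
def inverseSeries (R : Type u) [Ring R] : AddSubgroup (ℤ → R) where
  carrier := {f | ∃ m : ℤ, ∀ i < m, f i = 0}
  zero_mem' := ⟨0, fun _ _ => rfl⟩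
  add_mem' := by
    rintro f g ⟨p, hp⟩ ⟨q, hq⟩
    refine ⟨min p q, fun i hi => ?_⟩
    simp [hp i (by omega), hq i (by omega)]
  neg_mem' := by
    rintro f ⟨p, hp⟩
    exact ⟨p, fun i hi => by simp [hp i hi]⟩

namespace SkewInverse

section Shift

variable {R : Type u} [Ring R] {α : R ≃+* R} (δ : SkewDerivation (α : R →+* R))

/-- Left multiplication by `x`, from `x a = α(a) x + δ(a)`:
`x ∑ a_i x^{-i} = ∑ (α(a_i) x^{-(i-1)} + δ(a_i) x^{-i})`. -/
def mulX : inverseSeries R →+ inverseSeries R where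
  toFun f := ⟨fun n => α (f.1 (n + 1)) + δ.toAddMonoidHom (f.1 n), by
    obtain ⟨p, hp⟩ := f.2
    refine ⟨p - 1, fun i hi => ?_⟩
    simp only
    rw [hp _ (by omega), hp _ (by omega), map_zero, map_zero, add_zero]⟩
  map_zero' := by
    ext n
    simp
  map_add' f g := by
    ext n
    simp only [AddSubgroup.coe_add, Pi.add_apply, map_add]
    abel

/-- The additive endomorphism `-δ α⁻¹` of `R`. -/
def negDeltaInv : AddMonoid.End R :=
  -(δ.toAddMonoidHom.comp (α.symm : R →+ R))

/-- The operator `a ↦ α⁻¹ (-δ α⁻¹)^k (a)`, for which `x⁻¹ a = ∑_k invCoeff k a x^{-1-k}`. -/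
def invCoeff (k : ℕ) : R →+ R :=
  (α.symm : R →+ R).comp (negDeltaInv δ ^ k : AddMonoid.End R)

lemma apply_invCoeff_zero (a : R) : α (invCoeff δ 0 a) = a :=
  α.apply_symm_apply a

lemma apply_invCoeff_succ (k : ℕ) (a : R) :
    α (invCoeff δ (k + 1) a) = -δ.toAddMonoidHom (invCoeff δ k a) := by
  change α (α.symm ((negDeltaInv δ ^ (k + 1)) a)) = _
  rw [RingEquiv.apply_symm_apply, pow_succ']
  rfl

/-- Left multiplication by `x⁻¹`, from `x⁻¹ a = ∑_{k ≥ 0} α⁻¹ (-δ α⁻¹)^k (a) x^{-1-k}`: the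
coefficient of `x^{-n}` in `x⁻¹ ∑ a_i x^{-i}` is `∑_{k ≥ 0} α⁻¹ (-δ α⁻¹)^k (a_{n-1-k})`, where
all but finitely many summands vanish. -/
noncomputable def invXFun (f : inverseSeries R) (n : ℤ) : R :=
  ∑ᶠ k : ℕ, invCoeff δ k (f.1 (n - 1 - k))

lemma invXFun_eq {f : inverseSeries R} {p : ℤ} (hp : ∀ i < p, f.1 i = 0) {n : ℤ} {N : ℕ}
    (hN : n - p ≤ N) :
    invXFun δ f n = ∑ k ∈ Finset.range N, invCoeff δ k (f.1 (n - 1 - k)) := by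
  refine finsum_eq_sum_of_support_subset _ fun k hk => ?_
  by_contra hkN
  refine hk ?_
  simp only [Finset.coe_range, Set.mem_Iio, not_lt] at hkN
  simp only
  rw [hp _ (by omega), map_zero]

lemma invXFun_of_lt {f : inverseSeries R} {p : ℤ} (hp : ∀ i < p, f.1 i = 0) {n : ℤ}
    (hn : n < p + 1) : invXFun δ f n = 0 := by
  rw [invXFun_eq δ hp (N := 0) (by push_cast; omega), Finset.range_zero, Finset.sum_empty]

/-- Left multiplication by `x⁻¹` as an additive map. -/
noncomputable def mulInvX : inverseSeries R →+ inverseSeries R where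
  toFun f := ⟨invXFun δ f, by
    obtain ⟨p, hp⟩ := f.2
    exact ⟨p + 1, fun i hi => invXFun_of_lt δ hp hi⟩⟩
  map_zero' := by
    ext n
    simp [invXFun]
  map_add' f g := by
    obtain ⟨p, hp⟩ := f.2
    obtain ⟨q, hq⟩ := g.2
    ext n
    have hfg : ∀ i < min p q, (f + g).1 i = 0 := fun i hi => by
      simp [hp i (by omega), hq i (by omega)]
    simp only [AddSubgroup.coe_add, Pi.add_apply]
    rw [invXFun_eq δ (p := p) (N := (n - min p q).toNat) hp (by omega),
      invXFun_eq δ (p := q) (N := (n - min p q).toNat) hq (by omega),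
      invXFun_eq δ (N := (n - min p q).toNat) hfg (by omega), ← Finset.sum_add_distrib]
    simp

lemma mulX_mulInvX (f : inverseSeries R) : mulX δ (mulInvX δ f) = f := by
  obtain ⟨p, hp⟩ := f.2
  ext n
  change α (invXFun δ f (n + 1)) + δ.toAddMonoidHom (invXFun δ f n) = f.1 n
  rw [invXFun_eq δ hp (n := n + 1) (N := (n - p).toNat + 1) (by push_cast; omega),
    invXFun_eq δ hp (n := n) (N := (n - p).toNat) (by omega), Finset.sum_range_succ',
    map_add, map_sum, map_sum, apply_invCoeff_zero]
  have h : ∀ k : ℕ, α (invCoeff δ (k + 1) (f.1 (n + 1 - 1 - ((k + 1 : ℕ) : ℤ)))) =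
      -δ.toAddMonoidHom (invCoeff δ k (f.1 (n - 1 - k))) := fun k => by
    rw [apply_invCoeff_succ, show n + 1 - 1 - ((k + 1 : ℕ) : ℤ) = n - 1 - k by push_cast; ring]
  simp only [h, Finset.sum_neg_distrib]
  simp

lemma mulX_injective : Function.Injective (mulX δ) := by
  refine (injective_iff_map_eq_zero _).2 fun f hf => ?_
  obtain ⟨p, hp⟩ := f.2
  have h : ∀ n, α (f.1 (n + 1)) + δ.toAddMonoidHom (f.1 n) = 0 := fun n =>
    congrFun (congrArg Subtype.val hf) n
  have key : ∀ k : ℕ, f.1 (p - 1 + k) = 0 := by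
    intro k
    induction k with
    | zero => exact hp _ (by push_cast; omega)
    | succ k ih =>
      have := h (p - 1 + k)
      rw [ih, map_zero, add_zero, map_eq_zero_iff α α.injective] at this
      rw [← this, Nat.cast_succ, add_assoc]
  ext n
  by_cases hn : n < p
  · exact hp n hn
  · have := key (n - (p - 1)).toNat
    rwa [show p - 1 + ((n - (p - 1)).toNat : ℤ) = n by omega] at this

lemma mulInvX_mulX (f : inverseSeries R) : mulInvX δ (mulX δ f) = f :=
  mulX_injective δ (mulX_mulInvX δ _)

/-- Left multiplication by `x`, as an invertible additive endomorphism. -/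
noncomputable def unitX : (AddMonoid.End (inverseSeries R))ˣ where
  val := mulX δ
  inv := mulInvX δ
  val_inv := AddMonoidHom.ext (mulX_mulInvX δ)
  inv_val := AddMonoidHom.ext (mulInvX_mulX δ)

/-- Left multiplication by `x^n`, for an integer `n`. -/
noncomputable def powX (n : ℤ) : inverseSeries R →+ inverseSeries R :=
  ((unitX δ ^ n : (AddMonoid.End (inverseSeries R))ˣ) : AddMonoid.End (inverseSeries R))

lemma powX_zero (f : inverseSeries R) : powX δ 0 f = f := by
  simp only [powX, zpow_zero, Units.val_one]
  rfl

lemma powX_add (m n : ℤ) (f : inverseSeries R) : powX δ (m + n) f = powX δ m (powX δ n f) := by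
  simp only [powX, zpow_add, Units.val_mul]
  rfl

lemma powX_one (f : inverseSeries R) : powX δ 1 f = mulX δ f := by
  simp [powX, unitX]

lemma powX_neg_one (f : inverseSeries R) : powX δ (-1) f = mulInvX δ f := by
  simp only [powX, zpow_neg_one]
  rfl

/-- To prove a relation between series for all powers of `x`, it is enough to do so for `x`. -/
lemma powX_induction {P : inverseSeries R → inverseSeries R → ℤ → Prop}
    (f g : inverseSeries R) (h0 : P f g 0)
    (h1 : ∀ f g n, P f g n → P (mulX δ f) (mulX δ g) (n + 1))
    (h2 : ∀ f g n, P f g n → P (mulInvX δ f) (mulInvX δ g) (n - 1)) (n : ℤ) :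
    P (powX δ n f) (powX δ n g) n := by
  induction n using Int.induction_on with
  | zero => rwa [powX_zero, powX_zero]
  | succ i ih =>
    have := h1 _ _ _ ih
    rwa [← powX_one, ← powX_one, ← powX_add, ← powX_add, add_comm 1] at this
  | pred i ih =>
    have := h2 _ _ _ ih
    rwa [← powX_neg_one, ← powX_neg_one, ← powX_add, ← powX_add, neg_add_eq_sub] at this

lemma powX_of_lt {f : inverseSeries R} {p : ℤ} (hp : ∀ i < p, f.1 i = 0) (n : ℤ) :
    ∀ i < p - n, (powX δ n f).1 i = 0 := by
  refine powX_induction δ (P := fun f _ n => ∀ i < p - n, f.1 i = 0) f f (by simpa using hp)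
    (fun f _ n h i hi => ?_) (fun f _ n h i hi => ?_) n
  · change α (f.1 (i + 1)) + δ.toAddMonoidHom (f.1 i) = 0
    rw [h _ (by omega), h _ (by omega), map_zero, map_zero, add_zero]
  · exact invXFun_of_lt δ h (by omega)

end Shift

end SkewInverse

/-- The skew inverse Laurent series ring `R((x⁻¹; α, δ))`. -/
def SkewInverseLaurentSeries {R : Type u} [Ring R] {α : R ≃+* R}
    (_δ : SkewDerivation (α : R →+* R)) : Type u :=
  inverseSeries R

namespace SkewInverseLaurentSeries

open SkewInverse

variable {R : Type u} [Ring R] {α : R ≃+* R} {δ : SkewDerivation (α : R →+* R)}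

instance : AddCommGroup (SkewInverseLaurentSeries δ) :=
  inferInstanceAs (AddCommGroup (inverseSeries R))

/-- The coefficient `a_i` of `x^{-i}` in `∑ a_i x^{-i}`. -/
def coeff (f : SkewInverseLaurentSeries δ) (i : ℤ) : R := f.1 i

lemma exists_bound (f : SkewInverseLaurentSeries δ) : ∃ m : ℤ, ∀ i < m, f.coeff i = 0 := f.2

/-- Left multiplication by `x^n`. -/
noncomputable def xpow (n : ℤ) :
    SkewInverseLaurentSeries δ →+ SkewInverseLaurentSeries δ :=
  powX δ n

@[ext]
lemma ext {f g : SkewInverseLaurentSeries δ} (h : ∀ i, f.coeff i = g.coeff i) : f = g :=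
  Subtype.ext (funext h)

@[simp]
lemma coeff_zero (i : ℤ) : (0 : SkewInverseLaurentSeries δ).coeff i = 0 := rfl

@[simp]
lemma coeff_add (f g : SkewInverseLaurentSeries δ) (i : ℤ) :
    (f + g).coeff i = f.coeff i + g.coeff i := rfl

@[simp]
lemma coeff_neg (f : SkewInverseLaurentSeries δ) (i : ℤ) : (-f).coeff i = -f.coeff i := rfl

lemma xpow_of_lt {f : SkewInverseLaurentSeries δ} {p : ℤ} (hp : ∀ i < p, f.coeff i = 0) (n : ℤ) :
    ∀ i < p - n, (xpow n f).coeff i = 0 :=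
  powX_of_lt δ hp n

lemma coeff_xpow_one (f : SkewInverseLaurentSeries δ) (n : ℤ) :
    (xpow 1 f).coeff n = α (f.coeff (n + 1)) + δ.toAddMonoidHom (f.coeff n) :=
  congrArg (fun g : inverseSeries R => g.1 n) (powX_one δ f)

lemma xpow_zero (f : SkewInverseLaurentSeries δ) : xpow 0 f = f := powX_zero δ f

lemma xpow_add (m n : ℤ) (f : SkewInverseLaurentSeries δ) :
    xpow (m + n) f = xpow m (xpow n f) := powX_add δ m n f

/-- The coefficient of `x^{-n}` in `f g = ∑_i a_i (x^{-i} g)`, where `f = ∑_i a_i x^{-i}`;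
all but finitely many summands vanish. -/
noncomputable def mulFun (f g : SkewInverseLaurentSeries δ) (n : ℤ) : R :=
  ∑ᶠ i : ℤ, f.coeff i * (xpow (-i) g).coeff n

lemma mulFun_term {f g : SkewInverseLaurentSeries δ} {p q : ℤ} (hp : ∀ i < p, f.coeff i = 0)
    (hq : ∀ i < q, g.coeff i = 0) {i n : ℤ} (h : i < p ∨ n - q < i) :
    f.coeff i * (xpow (-i) g).coeff n = 0 := by
  rcases h with h | h
  · rw [hp i h, zero_mul]
  · rw [xpow_of_lt hq (-i) n (by omega), mul_zero]

lemma mulFun_eq {f g : SkewInverseLaurentSeries δ} {p q : ℤ} (hp : ∀ i < p, f.coeff i = 0)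
    (hq : ∀ i < q, g.coeff i = 0) {n : ℤ} (S : Finset ℤ) (hS : Finset.Icc p (n - q) ⊆ S) :
    mulFun f g n = ∑ i ∈ S, f.coeff i * (xpow (-i) g).coeff n := by
  refine finsum_eq_sum_of_support_subset _ fun i hi => ?_
  by_contra hiS
  refine hi (mulFun_term hp hq ?_)
  by_contra hc
  exact hiS (hS (Finset.mem_Icc.2 ⟨by omega, by omega⟩))

lemma mulFun_of_lt {f g : SkewInverseLaurentSeries δ} {p q : ℤ} (hp : ∀ i < p, f.coeff i = 0)
    (hq : ∀ i < q, g.coeff i = 0) {n : ℤ} (hn : n < p + q) : mulFun f g n = 0 := by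
  rw [mulFun_eq hp hq ∅ (by rw [Finset.Icc_eq_empty (by omega)]), Finset.sum_empty]

noncomputable instance : Mul (SkewInverseLaurentSeries δ) where
  mul f g := ⟨mulFun f g, by
    obtain ⟨p, hp⟩ := f.exists_bound
    obtain ⟨q, hq⟩ := g.exists_bound
    exact ⟨p + q, fun _ hi => mulFun_of_lt hp hq hi⟩⟩

lemma coeff_mul (f g : SkewInverseLaurentSeries δ) (n : ℤ) :
    (f * g).coeff n = ∑ᶠ i : ℤ, f.coeff i * (xpow (-i) g).coeff n := rfl

lemma coeff_mul_eq {f g : SkewInverseLaurentSeries δ} {p q : ℤ} (hp : ∀ i < p, f.coeff i = 0)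
    (hq : ∀ i < q, g.coeff i = 0) {n : ℤ} (S : Finset ℤ) (hS : Finset.Icc p (n - q) ⊆ S) :
    (f * g).coeff n = ∑ i ∈ S, f.coeff i * (xpow (-i) g).coeff n :=
  mulFun_eq hp hq S hS

/-- The series `a x^{-i}`. -/
def single (i : ℤ) (a : R) : SkewInverseLaurentSeries δ :=
  ⟨fun j => if j = i then a else 0, i, fun _ hj => if_neg (ne_of_lt hj)⟩

lemma coeff_single (i j : ℤ) (a : R) :
    (single i a : SkewInverseLaurentSeries δ).coeff j = if j = i then a else 0 := rfl

instance : One (SkewInverseLaurentSeries δ) := ⟨single 0 1⟩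

lemma coeff_one (j : ℤ) :
    (1 : SkewInverseLaurentSeries δ).coeff j = if j = 0 then 1 else 0 :=
  coeff_single 0 j 1

lemma deriv_one (δ : SkewDerivation (α : R →+* R)) : δ.toAddMonoidHom 1 = 0 := by
  have h : δ.toAddMonoidHom (1 * 1) = δ.toAddMonoidHom 1 * 1 + (α : R →+* R) 1 * δ.toAddMonoidHom 1 :=
    δ.leibniz' 1 1
  simpa using h

lemma xpow_one_single (i : ℤ) :
    xpow 1 (single i 1 : SkewInverseLaurentSeries δ) = single (i - 1) 1 := by
  ext n
  rw [coeff_xpow_one, coeff_single, coeff_single, coeff_single]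
  have h : (n + 1 = i) = (n = i - 1) := by
    rw [eq_sub_iff_add_eq]
  simp only [h, apply_ite α, apply_ite δ.toAddMonoidHom, map_one, map_zero, deriv_one, ite_self,
    add_zero]

lemma xpow_neg_one_add (i : ℤ) : xpow (-1) (single i 1 : SkewInverseLaurentSeries δ) =
    single (i + 1) 1 := by
  have h := xpow_one_single (δ := δ) (i + 1)
  rw [add_sub_cancel_right] at h
  rw [← h, ← xpow_add, neg_add_cancel, xpow_zero]

lemma xpow_single (n i : ℤ) :
    xpow n (single i 1 : SkewInverseLaurentSeries δ) = single (i - n) 1 := by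
  induction n using Int.induction_on with
  | zero => rw [xpow_zero, sub_zero]
  | succ k ih => rw [add_comm, xpow_add, ih, xpow_one_single]; congr 1; ring
  | pred k ih => rw [sub_eq_neg_add, xpow_add, ih, xpow_neg_one_add]; congr 1; ring

lemma support_finite (f g : SkewInverseLaurentSeries δ) (n : ℤ) :
    (Function.support fun i : ℤ => f.coeff i * (xpow (-i) g).coeff n).Finite := by
  obtain ⟨p, hp⟩ := f.exists_bound
  obtain ⟨q, hq⟩ := g.exists_bound
  refine (Set.finite_Icc p (n - q)).subset fun i hi => ?_
  by_contra hc
  refine hi (mulFun_term hp hq ?_)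
  rw [Set.mem_Icc] at hc
  omega

lemma xpow_one_mul (g h : SkewInverseLaurentSeries δ) : xpow 1 (g * h) = xpow 1 g * h := by
  obtain ⟨p, hp⟩ := g.exists_bound
  obtain ⟨q, hq⟩ := h.exists_bound
  have hp' : ∀ i < p - 1, (xpow 1 g).coeff i = 0 := xpow_of_lt hp 1
  have hl : ∀ a b : R, δ.toAddMonoidHom (a * b) =
      δ.toAddMonoidHom a * b + α a * δ.toAddMonoidHom b := δ.leibniz'
  ext n
  rw [coeff_xpow_one]
  have e1 := coeff_mul_eq hp hq (n := n + 1) (Finset.Icc p (n + 1 - q)) subset_rfl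
  have e2 := coeff_mul_eq hp hq (n := n) (Finset.Icc p (n + 1 - q))
    (Finset.Icc_subset_Icc_right (by omega))
  have e3 := coeff_mul_eq hp' hq (n := n) (Finset.Icc (p - 1) (n + 1 - q))
    (Finset.Icc_subset_Icc_right (by omega))
  have step : ∀ i : ℤ, (xpow (-(i - 1)) h).coeff n =
      α ((xpow (-i) h).coeff (n + 1)) + δ.toAddMonoidHom ((xpow (-i) h).coeff n) := fun i => by
    rw [show -(i - 1) = 1 + -i by ring, xpow_add, coeff_xpow_one]
  have e4 : ∑ i ∈ Finset.Icc (p - 1) (n + 1 - q), α (g.coeff (i + 1)) * (xpow (-i) h).coeff n =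
      ∑ i ∈ Finset.Icc p (n + 1 - q), α (g.coeff i) * (xpow (-(i - 1)) h).coeff n := by
    have e5 : ∑ i ∈ Finset.Icc p (n + 1 - q), α (g.coeff i) * (xpow (-(i - 1)) h).coeff n =
        ∑ i ∈ Finset.Icc p (n + 2 - q), α (g.coeff i) * (xpow (-(i - 1)) h).coeff n := by
      refine Finset.sum_subset (Finset.Icc_subset_Icc_right (by omega)) fun i h1 h2 => ?_
      rw [Finset.mem_Icc] at h1 h2
      rw [xpow_of_lt hq _ n (by omega), mul_zero]
    rw [e5]
    refine Finset.sum_bij' (fun i _ => i + 1) (fun i _ => i - 1) ?_ ?_ ?_ ?_ ?_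
    · intro i hi
      rw [Finset.mem_Icc] at hi ⊢
      omega
    · intro i hi
      rw [Finset.mem_Icc] at hi ⊢
      omega
    · intro i _
      ring
    · intro i _
      ring
    · intro i _
      rw [add_sub_cancel_right]
  have e6 : ∑ i ∈ Finset.Icc (p - 1) (n + 1 - q),
        δ.toAddMonoidHom (g.coeff i) * (xpow (-i) h).coeff n =
      ∑ i ∈ Finset.Icc p (n + 1 - q),
        δ.toAddMonoidHom (g.coeff i) * (xpow (-i) h).coeff n := by
    refine (Finset.sum_subset (Finset.Icc_subset_Icc_left (by omega)) fun i h1 h2 => ?_).symm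
    rw [Finset.mem_Icc] at h1 h2
    rw [hp i (by omega), map_zero, zero_mul]
  rw [e1, e2, e3]
  simp only [coeff_xpow_one, add_mul, Finset.sum_add_distrib]
  rw [e4, e6]
  simp only [step, map_sum, map_mul, hl, mul_add, Finset.sum_add_distrib]
  abel

lemma xpow_mul (n : ℤ) (g h : SkewInverseLaurentSeries δ) : xpow n (g * h) = xpow n g * h := by
  induction n using Int.induction_on with
  | zero => rw [xpow_zero, xpow_zero]
  | succ k ih => rw [add_comm, xpow_add, ih, xpow_add, xpow_one_mul]
  | pred k ih =>
    have h1 : xpow (-(k : ℤ)) g = xpow 1 (xpow (-(k : ℤ) - 1) g) := by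
      rw [← xpow_add, add_sub_cancel]
    rw [sub_eq_neg_add, xpow_add, ih, h1, ← xpow_one_mul, ← xpow_add, neg_add_cancel, xpow_zero,
      sub_eq_neg_add]

lemma mul_assoc' (f g h : SkewInverseLaurentSeries δ) : f * g * h = f * (g * h) := by
  obtain ⟨p, hp⟩ := f.exists_bound
  obtain ⟨q, hq⟩ := g.exists_bound
  obtain ⟨r, hr⟩ := h.exists_bound
  have hfg : ∀ i < p + q, (f * g).coeff i = 0 := fun i hi => mulFun_of_lt hp hq hi
  have hgh : ∀ i < q + r, (g * h).coeff i = 0 := fun i hi => mulFun_of_lt hq hr hi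
  ext n
  have inner : ∀ i ∈ Finset.Icc p (n - (q + r)), (xpow (-i) (g * h)).coeff n =
      ∑ j ∈ Finset.Icc (p + q) (n - r), (xpow (-i) g).coeff j * (xpow (-j) h).coeff n := by
    intro i hi
    rw [Finset.mem_Icc] at hi
    rw [xpow_mul]
    exact coeff_mul_eq (xpow_of_lt hq (-i)) hr _ (Finset.Icc_subset_Icc_left (by omega))
  have outer : ∀ j ∈ Finset.Icc (p + q) (n - r), (f * g).coeff j =
      ∑ i ∈ Finset.Icc p (n - (q + r)), f.coeff i * (xpow (-i) g).coeff j := by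
    intro j hj
    rw [Finset.mem_Icc] at hj
    exact coeff_mul_eq hp hq _ (Finset.Icc_subset_Icc_right (by omega))
  rw [coeff_mul_eq hp hgh _ subset_rfl, coeff_mul_eq hfg hr _ subset_rfl,
    Finset.sum_congr rfl fun i hi => congrArg (f.coeff i * ·) (inner i hi),
    Finset.sum_congr rfl fun j hj => congrArg (· * (xpow (-j) h).coeff n) (outer j hj)]
  simp only [Finset.sum_mul, Finset.mul_sum, mul_assoc]
  exact Finset.sum_comm

noncomputable instance : Ring (SkewInverseLaurentSeries δ) :=
  { (inferInstance : AddCommGroup (SkewInverseLaurentSeries δ)),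
    (inferInstance : Mul (SkewInverseLaurentSeries δ)),
    (inferInstance : One (SkewInverseLaurentSeries δ)) with
    left_distrib := fun f g h => by
      ext n
      simp only [coeff_add, coeff_mul, map_add, mul_add]
      exact finsum_add_distrib (support_finite f g n) (support_finite f h n)
    right_distrib := fun f g h => by
      ext n
      simp only [coeff_add, coeff_mul, add_mul]
      exact finsum_add_distrib (support_finite f h n) (support_finite g h n)
    zero_mul := fun f => by
      ext n
      simp [coeff_mul]
    mul_zero := fun f => by
      ext n
      simp [coeff_mul]
    mul_assoc := mul_assoc'
    one_mul := fun f => by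
      ext n
      rw [coeff_mul, finsum_eq_single _ 0 fun i hi => by rw [coeff_one, if_neg hi, zero_mul],
        coeff_one, if_pos rfl, one_mul, neg_zero, xpow_zero]
    mul_one := fun f => by
      ext n
      have h : ∀ i : ℤ, xpow (-i) (1 : SkewInverseLaurentSeries δ) = single i 1 := fun i => by
        change xpow (-i) (single 0 1) = _
        rw [xpow_single, sub_neg_eq_add, zero_add]
      rw [coeff_mul, finsum_eq_single _ n fun i hi => by
        rw [h, coeff_single, if_neg (Ne.symm hi), mul_zero], h, coeff_single, if_pos rfl, mul_one] }

end SkewInverseLaurentSeries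

/-- The skew inverse power series ring `R[[x⁻¹; α, δ]]`: the subring of `R((x⁻¹; α, δ))` of the
series `∑_{i ≥ 0} a_i x^{-i}`. -/
noncomputable def skewInversePowerSeries {R : Type u} [Ring R] {α : R ≃+* R}
    (δ : SkewDerivation (α : R →+* R)) : Subring (SkewInverseLaurentSeries δ) where
  carrier := {f | ∀ i < 0, f.coeff i = 0}
  zero_mem' := fun _ _ => rfl
  one_mem' := fun i hi => by
    rw [SkewInverseLaurentSeries.coeff_one, if_neg (ne_of_lt hi)]
  add_mem' := fun {f g} hf hg i hi => by
    rw [SkewInverseLaurentSeries.coeff_add, hf i hi, hg i hi, add_zero]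
  neg_mem' := fun {f} hf i hi => by
    rw [SkewInverseLaurentSeries.coeff_neg, hf i hi, neg_zero]
  mul_mem' := fun {_ _} hf hg _ hi => SkewInverseLaurentSeries.mulFun_of_lt hf hg (by omega)

/-! ### Leading terms of products -/

namespace SkewInverseLaurentSeries

variable {R : Type u} [Ring R] {α : R ≃+* R} {δ : SkewDerivation (α : R →+* R)}

/-! Everything is read off from leading terms. If `f` and `g` start with `a x^{-p}` and `b x^{-q}`,
then moving `x^{-p}` past `b` alters it, up to higher powers of `x^{-1}`, only by `α^{-p}`, so the
product starts at `x^{-(p+q)}` with coefficient `a α^{-p}(b)`; the derivation contributes only to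
later terms. Inserting a constant `r` between `f` and `g` gives `a α^{-p}(r) α^{-p}(b)`, and
`α^{-p}(r)` runs over all of `R`. Hence `f R g = 0` forces `a R α^{-p}(b) = 0`
(`leading_mul_mul_eq_zero`). For prime `R` this contradicts `a, b ≠ 0`. For semiprime `R`, take `g =
f`: compatibility turns `a s α^{-p}(a) = 0` into `a s a = 0`, so `a = 0`. Only constants are
inserted, and these lie in the power series ring, so both rings are covered at once. The Baer
property holds over every prime ring: a nonzero cyclic projective module embeds in the ring, so its
annihilator is `0`. -/

/-- The leading coefficient of `x^n f` is `α^n` of the leading coefficient of `f`. -/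
lemma coeff_xpow_sub {f : SkewInverseLaurentSeries δ} {p : ℤ} (hp : ∀ i < p, f.coeff i = 0)
    (n : ℤ) : (xpow n f).coeff (p - n) = ((α : RingAut R) ^ n) (f.coeff p) := by
  induction n using Int.induction_on with
  | zero => rw [xpow_zero, sub_zero, zpow_zero, RingAut.one_apply]
  | succ k ih =>
    rw [add_comm, xpow_add, coeff_xpow_one, xpow_of_lt hp _ (p - (1 + k)) (by omega), map_zero,
      add_zero, show p - (1 + k) + 1 = p - (k : ℤ) by ring, ih, zpow_add, zpow_one,
      RingAut.mul_apply]
  | pred k ih =>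
    -- Coefficients are explicit only for multiplication by `x`, so the downward step recovers
    -- `x^{-k} f` as `x (x^{-k-1} f)` and cancels `α`.
    apply α.injective
    have h : (xpow (-(k : ℤ)) f).coeff (p - -(k : ℤ)) =
        α ((xpow (-(k : ℤ) - 1) f).coeff (p - (-(k : ℤ) - 1))) := by
      rw [show -(k : ℤ) = 1 + (-(k : ℤ) - 1) by ring, xpow_add, coeff_xpow_one,
        xpow_of_lt hp _ (p - (1 + (-(k : ℤ) - 1))) (by omega), map_zero, add_zero]
      congr 2 <;> ring_nf
    rw [← h, ih, ← RingAut.mul_apply, ← zpow_one_add, add_sub_cancel]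

/-- Only the index `i = p` satisfies both `p ≤ i` and `i ≤ (p + q) - q`. The coefficients at `p` and
`q` may vanish, so the formula also applies when a constant factor kills the leading term of `g`. -/
lemma coeff_mul_add {f g : SkewInverseLaurentSeries δ} {p q : ℤ} (hp : ∀ i < p, f.coeff i = 0)
    (hq : ∀ i < q, g.coeff i = 0) :
    (f * g).coeff (p + q) = f.coeff p * ((α : RingAut R) ^ (-p)) (g.coeff q) := by
  rw [coeff_mul_eq hp hq {p} (by rw [add_sub_cancel_right, Finset.Icc_self]),
    Finset.sum_singleton, ← coeff_xpow_sub hq, show q - -p = p + q by ring]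

lemma coeff_single_zero_mul (r : R) (g : SkewInverseLaurentSeries δ) (n : ℤ) :
    (single 0 r * g).coeff n = r * g.coeff n := by
  rw [coeff_mul, finsum_eq_single _ 0 fun i hi => by rw [coeff_single, if_neg hi, zero_mul],
    coeff_single, if_pos rfl, neg_zero, xpow_zero]

/-- Makes the constant test elements available inside the subring. -/
lemma single_zero_mem (r : R) : single 0 r ∈ skewInversePowerSeries δ := fun i hi => by
  rw [coeff_single, if_neg (ne_of_lt hi)]

lemma exists_leading {f : SkewInverseLaurentSeries δ} (hf : f ≠ 0) :
    ∃ p : ℤ, f.coeff p ≠ 0 ∧ ∀ i < p, f.coeff i = 0 := by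
  obtain ⟨m, hm⟩ := f.exists_bound
  have hex : ∃ i, f.coeff i ≠ 0 := by
    by_contra! h
    exact hf (ext h)
  obtain ⟨p, hp, hmin⟩ := Int.exists_least_of_bdd (P := fun i => f.coeff i ≠ 0)
    ⟨m, fun i hi => not_lt.1 fun h => hi (hm i h)⟩ hex
  exact ⟨p, hp, fun i hi => by_contra fun h => absurd (hmin i h) (not_le.2 hi)⟩

/-- If `f R g = 0`, then `a R α^{-p}(b) = 0` for the leading terms `a x^{-p}` of `f` and
`b x^{-q}` of `g`. -/
lemma leading_mul_mul_eq_zero {f g : SkewInverseLaurentSeries δ} {p q : ℤ}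
    (hp : ∀ i < p, f.coeff i = 0) (hq : ∀ i < q, g.coeff i = 0)
    (h : ∀ r : R, f * single 0 r * g = 0) (s : R) :
    f.coeff p * s * ((α : RingAut R) ^ (-p)) (g.coeff q) = 0 := by
  -- The constant to insert is `r = α^p(s)`, which becomes `s` after passing `x^{-p}`.
  obtain ⟨r, rfl⟩ := ((α : RingAut R) ^ (-p)).surjective s
  have hq' : ∀ i < q, (single 0 r * g).coeff i = 0 := fun i hi => by
    rw [coeff_single_zero_mul, hq i hi, mul_zero]
  rw [mul_assoc, ← map_mul, ← coeff_single_zero_mul, ← coeff_mul_add hp hq', ← mul_assoc, h,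
    coeff_zero]

lemma eq_zero_or_eq_zero_of_isPrimeRing (hR : IsPrimeRing R) {f g : SkewInverseLaurentSeries δ}
    (h : ∀ r : R, f * single 0 r * g = 0) : f = 0 ∨ g = 0 := by
  by_contra! hfg
  obtain ⟨p, hp0, hp⟩ := exists_leading hfg.1
  obtain ⟨q, hq0, hq⟩ := exists_leading hfg.2
  rcases hR.2 _ _ (leading_mul_mul_eq_zero hp hq h) with h0 | h0
  · exact hp0 h0
  · exact hq0 ((map_eq_zero_iff _ ((α : RingAut R) ^ (-p)).injective).1 h0)

end SkewInverseLaurentSeries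

/-! ### Compatibility with integer powers of `α` -/

/-- Compatibility is an equivalence, so powers of `α` can be removed as well as added; negative
powers follow by applying it to `α^{-k-1}(b)`. -/
lemma IsCompatibleEndo.mul_zpow_eq_zero_iff {R : Type u} [Ring R] {α : R ≃+* R}
    (hα : IsCompatibleEndo (α : R →+* R)) (n : ℤ) (a b : R) :
    a * ((α : RingAut R) ^ n) b = 0 ↔ a * b = 0 := by
  induction n using Int.induction_on with
  | zero => rw [zpow_zero, RingAut.one_apply]
  | succ k ih =>
    rw [← ih, hα a (((α : RingAut R) ^ (k : ℤ)) b), add_comm, zpow_one_add, RingAut.mul_apply]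
    rfl
  | pred k ih =>
    rw [← ih, hα a (((α : RingAut R) ^ (-(k : ℤ) - 1)) b),
      show -(k : ℤ) = 1 + (-(k : ℤ) - 1) by ring, zpow_one_add, RingAut.mul_apply,
      add_sub_cancel_left]
    rfl

/-! ### Passage of primeness and semiprimeness to the series rings -/

namespace SkewInverseLaurentSeries

variable {R : Type u} [Ring R] {α : R ≃+* R} {δ : SkewDerivation (α : R →+* R)}

lemma eq_zero_of_isSemiprimeRing (hα : IsCompatibleEndo (α : R →+* R)) (hR : IsSemiprimeRing R)
    {f : SkewInverseLaurentSeries δ} (h : ∀ r : R, f * single 0 r * f = 0) : f = 0 := by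
  by_contra hf
  obtain ⟨p, hp0, hp⟩ := exists_leading hf
  exact hp0 (hR _ fun s =>
    (hα.mul_zpow_eq_zero_iff (-p) _ _).1 (leading_mul_mul_eq_zero hp hp h s))

lemma nontrivial_of_nontrivial [Nontrivial R] : Nontrivial (SkewInverseLaurentSeries δ) :=
  ⟨0, 1, fun h => zero_ne_one (α := R) (by
    have := congrArg (fun f => f.coeff 0) h
    rwa [coeff_zero, coeff_one, if_pos rfl] at this)⟩

lemma isPrimeRing (hR : IsPrimeRing R) : IsPrimeRing (SkewInverseLaurentSeries δ) := by
  have := hR.1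
  exact ⟨nontrivial_of_nontrivial, fun f g h =>
    eq_zero_or_eq_zero_of_isPrimeRing hR fun r => h (single 0 r)⟩

lemma isPrimeRing_powerSeries (hR : IsPrimeRing R) : IsPrimeRing (skewInversePowerSeries δ) := by
  have := hR.1
  have : Nontrivial (SkewInverseLaurentSeries δ) := nontrivial_of_nontrivial
  refine ⟨inferInstance, fun f g h => ?_⟩
  have := eq_zero_or_eq_zero_of_isPrimeRing hR (f := f.1) (g := g.1) fun r =>
    congrArg Subtype.val (h ⟨single 0 r, single_zero_mem r⟩)
  exact this.imp (fun h => Subtype.ext h) fun h => Subtype.ext h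

end SkewInverseLaurentSeries

/-! ### Cyclic projective modules over a prime ring -/

/-- The right annihilator of a cyclic projective module over a prime ring is `A` if the module is
zero, and `0` otherwise. -/
lemma IsPrimeRing.isRightCPBaer {A : Type u} [Ring A] (hA : IsPrimeRing A) : IsRightCPBaer A := by
  intro P _ _ hP ⟨p, hp⟩
  have hsurj : Function.Surjective (LinearMap.toSpanSingleton Aᵐᵒᵖ P p) := by
    rw [← LinearMap.range_eq_top, LinearMap.range_toSpanSingleton, hp]
  -- Projectivity splits `a ↦ p a`; the section `s` embeds `P` in `A` as a right ideal generated by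
  -- `s p`.
  obtain ⟨s, hs⟩ := Module.projective_lifting_property _ LinearMap.id hsurj
  by_cases he : s p = 0
  · have hp0 : p = 0 := by
      have := LinearMap.congr_fun hs p
      rw [LinearMap.comp_apply, he, map_zero, LinearMap.id_apply] at this
      exact this.symm
    have hP0 : ∀ x : P, x = 0 := fun x => by
      obtain ⟨a, rfl⟩ := hsurj x
      rw [LinearMap.toSpanSingleton_apply, hp0, smul_zero]
    refine ⟨1, IsIdempotentElem.one, Set.ext fun r => ?_⟩
    exact ⟨fun _ => ⟨r, (one_mul r).symm⟩, fun _ x => hP0 _⟩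
  · refine ⟨0, IsIdempotentElem.zero, Set.ext fun r => ⟨fun hr => ⟨0, ?_⟩, ?_⟩⟩
    · rw [mul_zero]
      -- If `r` kills `P`, applying `s` to `(p a) r = 0` gives `s(p) a r = 0` for every `a`, and
      -- primeness yields `r = 0`.
      refine (hA.2 (s p).unop r fun a => ?_).resolve_left fun h => he (MulOpposite.unop_injective h)
      have h := congrArg s (hr (MulOpposite.op a • p))
      rw [map_smul, map_smul, map_zero] at h
      simpa [mul_assoc] using congrArg MulOpposite.unop h
    · rintro ⟨t, rfl⟩ x
      rw [zero_mul, MulOpposite.op_zero, zero_smul]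

theorem proposition241 {R : Type u} [Ring R] (α : R ≃+* R) (δ : SkewDerivation (α : R →+* R))
    (hα : IsCompatibleEndo (α : R →+* R)) :
    (IsPrimeRing R →
      (IsPrimeRing (SkewInverseLaurentSeries δ) ∧ IsPrimeRing (skewInversePowerSeries δ)) ∧
      (IsRightCPBaer (SkewInverseLaurentSeries δ) ∧ IsRightCPBaer (skewInversePowerSeries δ))) ∧
    (IsSemiprimeRing R →
      IsSemiprimeRing (SkewInverseLaurentSeries δ) ∧
      IsSemiprimeRing (skewInversePowerSeries δ)) := by
  refine ⟨fun hR => ?_, fun hR => ⟨fun f h => ?_, fun f h => ?_⟩⟩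
  · have h1 := SkewInverseLaurentSeries.isPrimeRing (δ := δ) hR
    have h2 := SkewInverseLaurentSeries.isPrimeRing_powerSeries (δ := δ) hR
    exact ⟨⟨h1, h2⟩, h1.isRightCPBaer, h2.isRightCPBaer⟩
  · exact SkewInverseLaurentSeries.eq_zero_of_isSemiprimeRing hα hR fun r => h _
  · exact Subtype.ext (SkewInverseLaurentSeries.eq_zero_of_isSemiprimeRing hα hR fun r =>
      congrArg Subtype.val (h ⟨_, SkewInverseLaurentSeries.single_zero_mem r⟩))
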